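/- Let $(X,\mu)$ be a standard (nonatomic) Lebesgue probability space and let $T$ be a rank-one measure-preserving transformation of $(X,\mu)$, that is, $T$ is invertible almost everywhere with measure-preserving inverse and there are integers $r_n>1$ ($n\in\mathbb N=\{0,1,2,\dots\}$) and $s_{n,i}\ge 0$ ($0<i\le r_n$) such that, with $h_0=1$ and $h_{n+1}=r_nh_n+\sum_{0<i\le r_n}s_{n,i}$, one has $\sum_n (h_{n+1}-r_nh_n)/h_{n+1}<\infty$, and there are measurable sets $B_n$, $B_{n,i}$ ($0<i\le r_n$), $C_{n,i,j}$ ($0<i\le r_n$, $0<j\le s_{n,i}$) such that, for all $n$ and up to null sets: $\{B_{n,i}:0<i\le r_n\}$ is a partition of $B_n$; the levels $T^k(B_n)$, $0\le k<h_n$, are disjoint; $T^{h_n}(B_{n,i})=C_{n,i,1}$ if $s_{n,i}\ne 0$; $T^{h_n}(B_{n,i})=B_{n,i+1}$ if $s_{n,i}=0$ and $i<r_n$; $T(C_{n,i,j})=C_{n,i,j+1}$ if $j<s_{n,i}$; $T(C_{n,i,s_{n,i}})=B_{n,i+1}$ if $i<r_n$ and $s_{n,i}\neq 0$; $B_{n+1}=B_{n,1}$;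 and, finally, every measurable set can be approximated in measure arbitrarily well by unions of levels of the stage-$n$ towers $\{T^k(B_n):0\le k<h_n\}$ as $n$ varies. Fix such data, and for $n\ge m$ let $$I_{m,n}=\{i: 0\le i<h_n,\ T^i(B_n)\subseteq B_m\}.$$ Let $(k_n)_{n\in\mathbb N}$ be integers greater than $1$ with $k_n\mid k_{n+1}$ for all $n$, such that the set $K=\{m\in\mathbb N:\exists n\ (m\mid k_n)\}$ is infinite. Let $\mathcal O_K$ be the corresponding odometer: the map $(\alpha_n)\mapsto(\alpha_n+1)$ on the set of all $(\alpha_n)\in\prod_n\mathbb Z/k_n\mathbb Z$ with $\alpha_n\equiv\alpha_m \pmod{k_m}$ for all $m\le n$, with the probability measure that gives each set $\{\alpha:\alpha_n=i\}$ measure $1/k_n$. For $k\in K$, write $[i]_k$ for the residue class of $i$ modulo $k$. The following are equivalent. (I) $T$ is isomorphic to $\mathcal O_K$, that is, there is a measure-preserving, almost everywhere invertible map that intertwines the two transformations almost everywhere. (II) Both of the following hold. (IIa) For all $k\in K$ and all $\eta>0$ there is $N\in\mathbb N$ such that for all $n\ge m\ge N$ there is $j\in\mathbb Z/k\mathbb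 Z$ with $$\frac{|\{i\in I_{m,n}:[i]_k\ne j\}|}{|I_{m,n}|}<\eta.$$ (IIb) For all $l\in\mathbb N$ and all $\epsilon>0$ there are $k\in K$ and $N\ge l$ such that for all $m\ge N$ there is $D\subseteq\mathbb Z/k\mathbb Z$ with $$\frac{|\{0\le i\le h_m:[i]_k\in D\}\,\Delta\, I_{l,m}|}{|I_{l,m}|}<\epsilon.$$ -/

import Mathlib

open MeasureTheory Filter Topology
open scoped ENNReal symmDiff

/-- A (finite) measure-preserving transformation: a measure-preserving map that is invertible on a
set of full measure, with measure-preserving inverse. The map and its inverse are extended to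
total functions; the inverse is unique up to null sets. -/
structure MPTransformation {X : Type*} [MeasurableSpace X] (μ : Measure X) where
  toFun : X → X
  invFun : X → X
  measurePreserving : MeasurePreserving toFun μ μ
  measurePreserving_inv : MeasurePreserving invFun μ μ
  left_inv : ∀ᵐ x ∂μ, invFun (toFun x) = x
  right_inv : ∀ᵐ x ∂μ, toFun (invFun x) = x

namespace MPTransformation

variable {X : Type*} [MeasurableSpace X] {μ : Measure X}
variable {Y : Type*} [MeasurableSpace Y] {ν : Measure Y}

/-- The forward image `T ^ k (A)`, as an element of the measure algebra: it is represented by the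
preimage of `A` under the `k`-th iterate of the inverse of `T`. (The set-theoretic image under a
map that is only invertible almost everywhere may change by more than a null set if `A` is changed
by a null set; the preimage under the inverse does not have this defect.) -/
def image (T : MPTransformation μ) (k : ℕ) (A : Set X) : Set X :=
  (T.invFun^[k]) ⁻¹' A

/-- `φ` is a factor map from `T` to `S`. -/
def IsFactorMap (T : MPTransformation μ) (S : MPTransformation ν) (φ : X → Y) : Prop :=
  MeasurePreserving φ μ ν ∧ ∀ᵐ x ∂μ, φ (T.toFun x) = S.toFun (φ x)

/-- `T` and `S` are isomorphic: there is a factor map from `T` to `S` which is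
invertible almost everywhere. -/
def Isomorphic (T : MPTransformation μ) (S : MPTransformation ν) : Prop :=
  ∃ (φ : X → Y) (ψ : Y → X), T.IsFactorMap S φ ∧ MeasurePreserving ψ ν μ ∧
    (∀ᵐ x ∂μ, ψ (φ x) = x) ∧ (∀ᵐ y ∂ν, φ (ψ y) = y)

end MPTransformation

/-- The heights `h 0 = 1`, `h (n + 1) = r n * h n + ∑_{0 < i ≤ r n} s n i` of the towers determined
by the cutting parameter `r` and the spacer parameter `s`. -/
def rankOneHeight (r : ℕ → ℕ) (s : ℕ → ℕ → ℕ) : ℕ → ℕ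
  | 0 => 1
  | n + 1 => r n * rankOneHeight r s n + ∑ i ∈ Finset.Icc 1 (r n), s n i

/-- A presentation of `T` as a rank-one transformation by cutting and stacking: a cutting
parameter `r`, a spacer parameter `s` (`s n i` matters only for `0 < i ≤ r n`), and sets
`B n`, `Bsub n i` (`0 < i ≤ r n`), `C n i j` (`0 < i ≤ r n`, `0 < j ≤ s n i`).
All relations between sets are understood up to null sets. -/
structure RankOnePresentation {X : Type*} [MeasurableSpace X] {μ : Measure X}
    (T : MPTransformation μ) where
  r : ℕ → ℕ
  s : ℕ → ℕ → ℕ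
  B : ℕ → Set X
  Bsub : ℕ → ℕ → Set X
  C : ℕ → ℕ → ℕ → Set X
  one_lt_r : ∀ n, 1 < r n
  summable_spacers : Summable fun n : ℕ =>
    ((rankOneHeight r s (n + 1) : ℝ) - r n * rankOneHeight r s n) / rankOneHeight r s (n + 1)
  measurable_B : ∀ n, NullMeasurableSet (B n) μ
  measurable_Bsub : ∀ n, ∀ i ∈ Finset.Icc 1 (r n), NullMeasurableSet (Bsub n i) μ
  measurable_C : ∀ n, ∀ i ∈ Finset.Icc 1 (r n), ∀ j ∈ Finset.Icc 1 (s n i),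
    NullMeasurableSet (C n i j) μ
  /-- `{Bsub n i : 0 < i ≤ r n}` is a partition of `B n`. -/
  iUnion_Bsub : ∀ n, (⋃ i ∈ Finset.Icc 1 (r n), Bsub n i) =ᵐ[μ] B n
  disjoint_Bsub : ∀ n, ∀ i ∈ Finset.Icc 1 (r n), ∀ j ∈ Finset.Icc 1 (r n), i ≠ j →
    AEDisjoint μ (Bsub n i) (Bsub n j)
  /-- The levels of the stage-`n` tower are disjoint. -/
  disjoint_levels : ∀ n, ∀ a < rankOneHeight r s n, ∀ b < rankOneHeight r s n, a ≠ b →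
    AEDisjoint μ (T.image a (B n)) (T.image b (B n))
  image_Bsub_of_ne_zero : ∀ n, ∀ i ∈ Finset.Icc 1 (r n), s n i ≠ 0 →
    T.image (rankOneHeight r s n) (Bsub n i) =ᵐ[μ] C n i 1
  image_Bsub_of_eq_zero : ∀ n, ∀ i ∈ Finset.Icc 1 (r n), i < r n → s n i = 0 →
    T.image (rankOneHeight r s n) (Bsub n i) =ᵐ[μ] Bsub n (i + 1)
  image_C : ∀ n, ∀ i ∈ Finset.Icc 1 (r n), ∀ j ∈ Finset.Icc 1 (s n i), j < s n i →
    T.image 1 (C n i j) =ᵐ[μ] C n i (j + 1)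
  image_C_last : ∀ n, ∀ i ∈ Finset.Icc 1 (r n), i < r n → s n i ≠ 0 →
    T.image 1 (C n i (s n i)) =ᵐ[μ] Bsub n (i + 1)
  B_succ : ∀ n, B (n + 1) =ᵐ[μ] Bsub n 1
  /-- The levels of the towers are dense in the `σ`-algebra: every measurable set is approximated
  arbitrarily well by a union of levels of one of the towers. -/
  dense_levels : ∀ A : Set X, MeasurableSet A → ∀ ε : ℝ≥0∞, 0 < ε →
    ∃ n, ∃ J ⊆ Finset.range (rankOneHeight r s n), μ (A ∆ ⋃ i ∈ J, T.image i (B n)) < ε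

namespace RankOnePresentation

variable {X : Type*} [MeasurableSpace X] {μ : Measure X} {T : MPTransformation μ}

/-- The height of the stage-`n` tower. -/
def h (P : RankOnePresentation T) (n : ℕ) : ℕ := rankOneHeight P.r P.s n

open scoped Classical in
/-- `I m n` is the set of indices of those levels of the stage-`n` tower that are contained in the
base `B m` of the stage-`m` tower. -/
noncomputable def I (P : RankOnePresentation T) (m n : ℕ) : Finset ℕ :=
  {i ∈ Finset.range (P.h n) | T.image i (P.B n) ≤ᵐ[μ] P.B m}

end RankOnePresentation

/-- A sequence of integers greater than one, each of which divides the next one. -/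
structure OdometerSequence where
  k : ℕ → ℕ
  one_lt : ∀ n, 1 < k n
  dvd_succ : ∀ n, k n ∣ k (n + 1)

namespace OdometerSequence

variable (κ : OdometerSequence)

instance (n : ℕ) : NeZero (κ.k n) := ⟨(Nat.zero_lt_of_lt (κ.one_lt n)).ne'⟩

theorem dvd {m n : ℕ} (h : m ≤ n) : κ.k m ∣ κ.k n :=
  Nat.le_induction dvd_rfl (fun n _ ih => ih.trans (κ.dvd_succ n)) n h

/-- The set of all factors of the terms of the sequence. -/
def factors : Set ℕ := {m | ∃ n, m ∣ κ.k n}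

/-- The space of the odometer: all sequences `α ∈ ∏ n, ℤ/k_n` with `α_n ≡ α_m` modulo `k_m`
whenever `m ≤ n`, as a subgroup of the product. -/
def space : AddSubgroup (∀ n, ZMod (κ.k n)) where
  carrier := {α | ∀ (m n : ℕ) (h : m ≤ n), ZMod.castHom (κ.dvd h) (ZMod (κ.k m)) (α n) = α m}
  zero_mem' := fun m n h => by simp only [Pi.zero_apply, map_zero]
  add_mem' := fun {a b} ha hb m n h => by
    simp only [Pi.add_apply, map_add]; rw [ha m n h, hb m n h]
  neg_mem' := fun {a} ha m n h => by
    simp only [Pi.neg_apply, map_neg]; rw [ha m n h]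

theorem isClosed_space : IsClosed (κ.space : Set (∀ n, ZMod (κ.k n))) := by
  have : (κ.space : Set (∀ n, ZMod (κ.k n))) = ⋂ (m : ℕ) (n : ℕ) (h : m ≤ n),
      {α | ZMod.castHom (κ.dvd h) (ZMod (κ.k m)) (α n) = α m} := by
    ext α; simp [space]
  rw [this]
  refine isClosed_iInter fun m => isClosed_iInter fun n => isClosed_iInter fun h => ?_
  exact isClosed_eq (continuous_of_discreteTopology.comp (continuous_apply n)) (continuous_apply m)

instance : CompactSpace κ.space := isCompact_iff_compactSpace.mp κ.isClosed_space.isCompact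


/-- The sequence `(1, 1, 1, …)`. -/
def one : κ.space := ⟨fun _ => 1, fun m _ h => map_one (ZMod.castHom (κ.dvd h) (ZMod (κ.k m)))⟩

/-- The natural measure on the odometer, that is, its normalized Haar measure. It is the unique
measure which gives every set `{α | α_n = i}` the measure `1 / k_n`
(see `measure_cylinder`). -/
noncomputable def measure : Measure κ.space :=
  Measure.addHaarMeasure (⊤ : TopologicalSpace.PositiveCompacts κ.space)

instance : Measure.IsAddHaarMeasure κ.measure := by
  unfold measure; infer_instance

instance : IsProbabilityMeasure κ.measure :=
  ⟨by
    have h := Measure.addHaarMeasure_self (K₀ := (⊤ : TopologicalSpace.PositiveCompacts κ.space))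
    rwa [TopologicalSpace.PositiveCompacts.coe_top] at h⟩

theorem measure_cylinder (n : ℕ) (i : ZMod (κ.k n)) :
    κ.measure {α | (α : ∀ n, ZMod (κ.k n)) n = i} = (κ.k n : ℝ≥0∞)⁻¹ := by
  have hm : ∀ j : ZMod (κ.k n),
      MeasurableSet {α : κ.space | (α : ∀ n, ZMod (κ.k n)) n = j} := fun j =>
    measurableSet_eq_fun ((measurable_pi_apply n).comp measurable_subtype_coe) measurable_const
  have hone : ∀ a : ℕ, ((a • κ.one : κ.space) : ∀ n, ZMod (κ.k n)) n = a := fun a => by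
    simp [one]
  have hc : ∀ j : ZMod (κ.k n), κ.measure {α | (α : ∀ n, ZMod (κ.k n)) n = j} =
      κ.measure {α | (α : ∀ n, ZMod (κ.k n)) n = 0} := fun j => by
    rw [← measure_preimage_add κ.measure (j.val • κ.one) {α | (α : ∀ n, ZMod (κ.k n)) n = j}]
    congr 1
    ext α
    have := hone j.val
    simp only [Set.mem_preimage, Set.mem_ofPred_eq, AddSubgroup.coe_add, Pi.add_apply, this,
      ZMod.natCast_zmod_val, add_eq_left]
  have hsum : ∑ j : ZMod (κ.k n), κ.measure {α | (α : ∀ n, ZMod (κ.k n)) n = j} = 1 := by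
    rw [← measure_univ (μ := κ.measure), ← measure_biUnion_finset]
    · congr 1
      ext α
      simp
    · intro a _ b _ hab
      exact Set.disjoint_left.mpr fun α ha hb => hab (ha.symm.trans hb)
    · exact fun j _ => hm j
  rw [hc i]
  simp only [hc, Finset.sum_const, Finset.card_univ, ZMod.card, nsmul_eq_mul] at hsum
  exact ENNReal.eq_inv_of_mul_eq_one_left (by rwa [mul_comm])

/-- The odometer given by the sequence `κ`: the map `(α_n) ↦ (α_n + 1)`, with its natural
measure. -/
noncomputable def odometer : MPTransformation κ.measure where
  toFun := fun α => α + κ.one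
  invFun := fun α => α - κ.one
  measurePreserving := measurePreserving_add_right κ.measure κ.one
  measurePreserving_inv := measurePreserving_sub_right κ.measure κ.one
  left_inv := Eventually.of_forall fun α => add_sub_cancel_right α κ.one
  right_inv := Eventually.of_forall fun α => sub_add_cancel α κ.one

end OdometerSequence

/-! Write `h` for the tower heights and μ for the measure. Everything rests on the fact that, for `n
≥ m`, the base of tower `m` is the union of the levels of tower `n` indexed by `I m n`, so that
|I_{m,n}| μ(B_n) = μ(B_m), while the towers fill the space in the limit.

From an isomorphism to the residue conditions: a coordinate of the isomorphism, reduced modulo k, is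
a function f into ℤ/k with f ∘ T = f + 1. Since f is nearly constant on most levels of a late tower,
and T carries level to level adding 1 to f, it is nearly constant on the base
(`eventually_base_concentrated`). If f is mostly a on B_m and mostly b on B_n, then most i in
I_{m,n} satisfy i + b = a, which is (IIa). For (IIb), B_l is close to the preimage of a cylinder,
and every level of tower m on which the two disagree at the typical value costs at least half of its
measure.

From the residue conditions to an isomorphism: (IIa) along a fast sequence of stages makes the index
of the level containing x, corrected by constants c_t, converge in the odometer for almost every x,
by Borel–Cantelli. The limit φ is equivariant because almost every x eventually avoids the top
level, and equivariance alone forces φ to preserve measure. By (IIb) each base B_l is a φ-preimage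
modulo null sets (`base_approx_preimage`), hence so is every level and every measurable set. On a
standard Borel space this makes φ invertible almost everywhere. -/

namespace MPTransformation

variable {X : Type*} [MeasurableSpace X] {μ : Measure X}

/-! ### Forward images in the measure algebra. -/

theorem image_image (T : MPTransformation μ) (a b : ℕ) (A : Set X) :
    T.image a (T.image b A) = T.image (a + b) A := by
  simp only [image, ← Set.preimage_comp, ← Function.iterate_add, add_comm a b]

theorem image_zero (T : MPTransformation μ) (A : Set X) : T.image 0 A = A := rfl

theorem image_ae_congr (T : MPTransformation μ) (k : ℕ) {A A' : Set X} (h : A =ᵐ[μ] A') :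
    T.image k A =ᵐ[μ] T.image k A' :=
  (T.measurePreserving_inv.iterate k).quasiMeasurePreserving.preimage_ae_eq h

theorem measurableSet_image (T : MPTransformation μ) (k : ℕ) {A : Set X} (h : MeasurableSet A) :
    MeasurableSet (T.image k A) :=
  (T.measurePreserving_inv.iterate k).measurable h

theorem measureReal_image (T : MPTransformation μ) (k : ℕ) {A : Set X} (h : MeasurableSet A) :
    μ.real (T.image k A) = μ.real A :=
  (T.measurePreserving_inv.iterate k).measureReal_preimage h.nullMeasurableSet

end MPTransformation

/-! ### Towers and their refinement by later towers. -/

namespace RankOnePresentation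

variable {X : Type*} [MeasurableSpace X] {μ : Measure X} {T : MPTransformation μ}
  (P : RankOnePresentation T)

/-- A measurable version of the base of the stage-`n` tower. -/
def base (n : ℕ) : Set X := toMeasurable μ (P.B n)

/-- A measurable version of the `i`-th level of the stage-`n` tower. -/
def level (n i : ℕ) : Set X := T.image i (P.base n)

/-- The union of the levels of the stage-`n` tower with indices in `J`. -/
def levels (n : ℕ) (J : Finset ℕ) : Set X := ⋃ i ∈ J, P.level n i

/-- The position in the stage-`n + 1` tower of the `i + 1`-st copy of the stage-`n` tower. -/
def offset (n i : ℕ) : ℕ := i * P.h n + ∑ j ∈ Finset.Icc 1 i, P.s n j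

theorem mem_levels {n : ℕ} {J : Finset ℕ} {x : X} :
    x ∈ P.levels n J ↔ ∃ i ∈ J, x ∈ P.level n i := by
  simp [levels]

theorem base_ae_eq (n : ℕ) : P.base n =ᵐ[μ] P.B n := (P.measurable_B n).toMeasurable_ae_eq

theorem measurableSet_base (n : ℕ) : MeasurableSet (P.base n) := measurableSet_toMeasurable _ _

theorem measurableSet_level (n i : ℕ) : MeasurableSet (P.level n i) :=
  T.measurableSet_image i (P.measurableSet_base n)

theorem measurableSet_levels (n : ℕ) (J : Finset ℕ) : MeasurableSet (P.levels n J) :=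
  Finset.measurableSet_biUnion _ fun i _ => P.measurableSet_level n i

theorem level_ae_eq (n i : ℕ) : P.level n i =ᵐ[μ] T.image i (P.B n) :=
  T.image_ae_congr i (P.base_ae_eq n)

theorem measureReal_level (n i : ℕ) : μ.real (P.level n i) = μ.real (P.base n) :=
  T.measureReal_image i (P.measurableSet_base n)

theorem aedisjoint_level {n a b : ℕ} (ha : a < P.h n) (hb : b < P.h n) (hab : a ≠ b) :
    AEDisjoint μ (P.level n a) (P.level n b) :=
  (P.disjoint_levels n a ha b hb hab).congr (P.level_ae_eq n a) (P.level_ae_eq n b)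

theorem measureReal_levels [IsFiniteMeasure μ] {n : ℕ} {J : Finset ℕ} (hJ : ∀ i ∈ J, i < P.h n) :
    μ.real (P.levels n J) = J.card * μ.real (P.base n) := by
  rw [levels, measureReal_biUnion_finset₀
    (fun a ha b hb hab => P.aedisjoint_level (hJ a ha) (hJ b hb) hab)
    (fun i _ => (P.measurableSet_level n i).nullMeasurableSet)]
  simp [measureReal_level]

theorem measureReal_levels_le [IsFiniteMeasure μ] (n : ℕ) (J : Finset ℕ) :
    μ.real (P.levels n J) ≤ J.card * μ.real (P.base n) := by
  refine (measureReal_biUnion_finset_le J _).trans ?_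
  simp [measureReal_level]

theorem h_zero : P.h 0 = 1 := rfl

theorem h_succ (n : ℕ) : P.h (n + 1) = P.offset n (P.r n) := rfl

theorem offset_succ (n i : ℕ) : P.offset n (i + 1) = P.offset n i + P.h n + P.s n (i + 1) := by
  simp only [offset, Finset.sum_Icc_succ_top (Nat.le_add_left 1 i)]
  ring

theorem offset_mono (n : ℕ) : Monotone (P.offset n) :=
  monotone_nat_of_le_succ fun i => by rw [offset_succ]; omega

theorem offset_add_h_le {n i : ℕ} (hi : i < P.r n) : P.offset n i + P.h n ≤ P.h (n + 1) := by
  rw [h_succ]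
  refine le_trans ?_ (P.offset_mono n hi)
  rw [Nat.succ_eq_add_one, offset_succ]
  omega

theorem two_pow_le_h (n : ℕ) : 2 ^ n ≤ P.h n := by
  induction n with
  | zero => simp [h_zero]
  | succ n ih =>
    have h1 := P.one_lt_r n
    have h2 : 2 * P.h n ≤ P.r n * P.h n := Nat.mul_le_mul_right _ h1
    rw [h_succ, offset, pow_succ]
    omega

theorem h_pos (n : ℕ) : 0 < P.h n := lt_of_lt_of_le (by positivity) (P.two_pow_le_h n)

theorem C_ae_eq {n i j : ℕ} (hi : i ∈ Finset.Icc 1 (P.r n)) (hj : j < P.s n i) :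
    T.image (P.h n + j) (P.Bsub n i) =ᵐ[μ] P.C n i (j + 1) := by
  induction j with
  | zero => exact P.image_Bsub_of_ne_zero n i hi (by omega)
  | succ j ih =>
    have h1 := T.image_ae_congr 1 (ih (by omega))
    rw [T.image_image] at h1
    have h2 := P.image_C n i hi (j + 1) (by simp; omega) hj
    rw [show P.h n + (j + 1) = 1 + (P.h n + j) by ring]
    exact h1.trans h2

theorem image_Bsub {n i : ℕ} (hi : 0 < i) (hir : i < P.r n) :
    T.image (P.h n + P.s n i) (P.Bsub n i) =ᵐ[μ] P.Bsub n (i + 1) := by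
  have hmem : i ∈ Finset.Icc 1 (P.r n) := by simp; omega
  by_cases hs : P.s n i = 0
  · rw [hs]
    exact P.image_Bsub_of_eq_zero n i hmem hir hs
  · obtain ⟨j, hj⟩ := Nat.exists_eq_succ_of_ne_zero hs
    have h1 := T.image_ae_congr 1 (P.C_ae_eq hmem (show j < P.s n i by omega))
    rw [T.image_image] at h1
    have h2 := P.image_C_last n i hmem hir hs
    rw [show P.h n + P.s n i = 1 + (P.h n + j) by omega]
    rw [show P.s n i = j + 1 from hj] at h2
    exact h1.trans h2

/-- The first piece is the new base, and passing from one piece to the next takes `h n` steps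
through the tower plus the number of spacers, which is exactly the increment of `offset`. -/
theorem Bsub_ae_eq {n i : ℕ} (hi : i < P.r n) :
    P.Bsub n (i + 1) =ᵐ[μ] P.level (n + 1) (P.offset n i) := by
  induction i with
  | zero =>
    have h1 : P.offset n 0 = 0 := by simp [offset]
    rw [h1]
    exact (P.B_succ n).symm.trans (P.base_ae_eq (n + 1)).symm
  | succ i ih =>
    have h1 := T.image_ae_congr (P.h n + P.s n (i + 1)) (ih (by omega))
    rw [level, T.image_image] at h1
    have h2 := P.image_Bsub (Nat.succ_pos i) hi
    rw [level, offset_succ,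
      show P.offset n i + P.h n + P.s n (i + 1) = P.h n + P.s n (i + 1) + P.offset n i by ring]
    exact h2.symm.trans h1

theorem ae_mem_base_iff_offset (n : ℕ) :
    ∀ᵐ x ∂μ, x ∈ P.base n ↔ ∃ i < P.r n, x ∈ P.level (n + 1) (P.offset n i) := by
  have h : ∀ᵐ x ∂μ, ∀ i, i < P.r n →
      (x ∈ P.Bsub n (i + 1) ↔ x ∈ P.level (n + 1) (P.offset n i)) :=
    ae_all_iff.2 fun i => eventually_imp_distrib_left.2 fun hi => (P.Bsub_ae_eq hi).mem_iff
  filter_upwards [h, (P.base_ae_eq n).mem_iff, (P.iUnion_Bsub n).mem_iff] with x h1 h2 h3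
  rw [h2, ← h3]
  simp only [Set.mem_iUnion, exists_prop, Finset.mem_Icc]
  constructor
  · rintro ⟨i, hi, hx⟩
    obtain ⟨j, rfl⟩ := Nat.exists_eq_succ_of_ne_zero (show i ≠ 0 by omega)
    exact ⟨j, by omega, (h1 j (by omega)).1 hx⟩
  · rintro ⟨i, hi, hx⟩
    exact ⟨i + 1, by omega, (h1 i hi).2 hx⟩

theorem ae_mem_level_add_iff {m n : ℕ} {J : Finset ℕ}
    (h : ∀ᵐ x ∂μ, x ∈ P.base m ↔ ∃ c ∈ J, x ∈ P.level n c) (i : ℕ) :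
    ∀ᵐ x ∂μ, x ∈ P.level m i ↔ ∃ c ∈ J, x ∈ P.level n (i + c) := by
  filter_upwards [(T.measurePreserving_inv.iterate i).quasiMeasurePreserving.ae h] with x hx
  simp only [level, ← T.image_image i]
  exact hx

/-- Iterates the one-stage decomposition given by the offsets. The bound `c + P.h m ≤ P.h n` records
that the whole copy of tower `m` starting at level `c` fits into tower `n`. The set `J` is later
identified with `I m n`. -/
theorem exists_base_eq_levels {m n : ℕ} (hmn : m ≤ n) :
    ∃ J : Finset ℕ, J.Nonempty ∧ (∀ c ∈ J, c + P.h m ≤ P.h n) ∧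
      ∀ᵐ x ∂μ, x ∈ P.base m ↔ ∃ c ∈ J, x ∈ P.level n c := by
  induction n, hmn using Nat.le_induction with
  | base => exact ⟨{0}, by simp, by simp, by simp [level, MPTransformation.image_zero]⟩
  | succ n hmn ih =>
    obtain ⟨J, hne, hJ, hB⟩ := ih
    have hr : 0 < P.r n := (P.one_lt_r n).le
    refine ⟨Finset.image₂ (fun c i => c + P.offset n i) J (Finset.range (P.r n)),
      hne.image₂ (by simp; omega), ?_, ?_⟩
    · intro c hc
      simp only [Finset.mem_image₂, Finset.mem_range] at hc
      obtain ⟨a, ha, i, hi, rfl⟩ := hc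
      have := P.offset_add_h_le hi
      have := hJ a ha
      omega
    · have h2 : ∀ᵐ x ∂μ, x ∈ P.base n ↔
          ∃ c ∈ (Finset.range (P.r n)).image (P.offset n), x ∈ P.level (n + 1) c := by
        filter_upwards [P.ae_mem_base_iff_offset n] with x hx
        simp [hx]
      filter_upwards [hB, ae_all_iff.2 (P.ae_mem_level_add_iff h2)] with x hx h3
      rw [hx]
      simp only [h3, Finset.mem_image₂, Finset.mem_image, Finset.mem_range]
      constructor
      · rintro ⟨c, hc, _, ⟨i, hi, rfl⟩, hx⟩
        exact ⟨_, ⟨c, hc, i, hi, rfl⟩, hx⟩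
      · rintro ⟨_, ⟨c, hc, i, hi, rfl⟩, hx⟩
        exact ⟨c, hc, _, ⟨i, hi, rfl⟩, hx⟩

theorem ae_mem_tower_of_le {m n : ℕ} (hmn : m ≤ n) :
    ∀ᵐ x ∂μ, x ∈ P.levels m (Finset.range (P.h m)) → x ∈ P.levels n (Finset.range (P.h n)) := by
  obtain ⟨J, -, hJ, hB⟩ := P.exists_base_eq_levels hmn
  filter_upwards [ae_all_iff.2 (P.ae_mem_level_add_iff hB)] with x hx h
  obtain ⟨i, hi, hxi⟩ := P.mem_levels.1 h
  obtain ⟨c, hc, hxc⟩ := (hx i).1 hxi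
  have := hJ c hc
  rw [Finset.mem_range] at hi
  exact P.mem_levels.2 ⟨i + c, by simp; omega, hxc⟩

theorem measureReal_base_eq [IsFiniteMeasure μ] {m n : ℕ} {J : Finset ℕ} (hJ : ∀ c ∈ J, c < P.h n)
    (hB : ∀ᵐ x ∂μ, x ∈ P.base m ↔ ∃ c ∈ J, x ∈ P.level n c) :
    μ.real (P.base m) = J.card * μ.real (P.base n) := by
  rw [← P.measureReal_levels hJ]
  refine measureReal_congr (eventuallyEq_set.2 ?_)
  simpa only [mem_levels] using hB

theorem lt_h_of_mem_I {m n c : ℕ} (hc : c ∈ P.I m n) : c < P.h n := by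
  simp only [I, Finset.mem_filter, Finset.mem_range] at hc
  exact hc.1

theorem ae_eq_of_mem_level (n : ℕ) :
    ∀ᵐ x ∂μ, ∀ a < P.h n, ∀ b < P.h n, x ∈ P.level n a → x ∈ P.level n b → a = b := by
  simp only [ae_all_iff, eventually_imp_distrib_left]
  refine fun a ha b hb => ?_
  by_cases hab : a = b
  · simp [hab]
  filter_upwards [measure_eq_zero_iff_ae_notMem.1 (P.aedisjoint_level ha hb hab)] with x hx h1 h2
  exact (hx ⟨h1, h2⟩).elim

/-! ### Measures of towers and bases, and approximation by levels. -/

variable [IsProbabilityMeasure μ]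

theorem exists_levels_approx {A : Set X} (hA : MeasurableSet A) {ε : ℝ} (hε : 0 < ε) :
    ∃ n, ∃ J ⊆ Finset.range (P.h n), μ.real (A ∆ P.levels n J) < ε := by
  obtain ⟨n, J, hJ, h⟩ := P.dense_levels A hA (ENNReal.ofReal ε) (by simpa using hε)
  refine ⟨n, J, hJ, ?_⟩
  have h1 : P.levels n J =ᵐ[μ] ⋃ i ∈ J, T.image i (P.B n) :=
    EventuallyEq.biUnion J.finite_toSet fun i _ => P.level_ae_eq n i
  have h2 : (A ∆ P.levels n J : Set X) =ᵐ[μ] A ∆ ⋃ i ∈ J, T.image i (P.B n) :=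
    (ae_eq_refl A).symmDiff h1
  rw [measureReal_congr h2]
  exact (ENNReal.lt_ofReal_iff_toReal_lt (measure_ne_top _ _)).1 h

theorem exists_tower_gt {ε : ℝ} (hε : 0 < ε) :
    ∃ n, 1 - ε < P.h n * μ.real (P.base n) := by
  obtain ⟨n, J, hJ, h⟩ := P.exists_levels_approx MeasurableSet.univ hε
  refine ⟨n, ?_⟩
  have h1 : (Set.univ ∆ P.levels n J : Set X) = (P.levels n J)ᶜ := by
    ext; simp [Set.mem_symmDiff]
  rw [h1, measureReal_compl (P.measurableSet_levels n J), probReal_univ] at h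
  have h2 := P.measureReal_levels_le n J
  have h3 : (J.card : ℝ) ≤ P.h n := by
    exact_mod_cast (Finset.card_le_card hJ).trans_eq (Finset.card_range _)
  have h4 := mul_le_mul_of_nonneg_right h3 (measureReal_nonneg (μ := μ) (s := P.base n))
  linarith

theorem measureReal_tower (n : ℕ) :
    μ.real (P.levels n (Finset.range (P.h n))) = P.h n * μ.real (P.base n) := by
  rw [P.measureReal_levels (by simp), Finset.card_range]

theorem monotone_tower : Monotone fun n => (P.h n : ℝ) * μ.real (P.base n) := by
  intro m n hmn
  simp only [← measureReal_tower]
  refine ENNReal.toReal_mono (measure_ne_top _ _) (measure_mono_ae (P.ae_mem_tower_of_le hmn))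

theorem tower_le_one (n : ℕ) : P.h n * μ.real (P.base n) ≤ 1 := by
  rw [← measureReal_tower]
  exact measureReal_le_one

theorem tendsto_tower : Tendsto (fun n => (P.h n : ℝ) * μ.real (P.base n)) atTop (𝓝 1) := by
  refine tendsto_order.2 ⟨fun a ha => ?_, fun a ha => .of_forall fun n =>
    (P.tower_le_one n).trans_lt ha⟩
  obtain ⟨n, hn⟩ := P.exists_tower_gt (sub_pos.2 ha)
  filter_upwards [eventually_ge_atTop n] with m hm
  have := P.monotone_tower hm
  simp only at this
  linarith

/-- Late towers have positive measure, and the base contains at least one level of each of them. -/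
theorem measureReal_base_pos (n : ℕ) : 0 < μ.real (P.base n) := by
  have h1 : ∀ᶠ m in atTop, 0 < P.h m * μ.real (P.base m) :=
    P.tendsto_tower.eventually (lt_mem_nhds one_pos)
  obtain ⟨m, hm, hnm⟩ := (h1.and (eventually_ge_atTop n)).exists
  obtain ⟨J, hne, hJ, hB⟩ := P.exists_base_eq_levels hnm
  have := P.h_pos n
  rw [P.measureReal_base_eq (fun c hc => by have := hJ c hc; omega) hB]
  have h2 : (0 : ℝ) < J.card := by exact_mod_cast hne.card_pos
  have h3 : 0 < μ.real (P.base m) := pos_of_mul_pos_right hm (Nat.cast_nonneg _)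
  positivity

theorem tendsto_measureReal_base : Tendsto (fun n => μ.real (P.base n)) atTop (𝓝 0) := by
  refine squeeze_zero (fun n => measureReal_nonneg) (fun n => ?_)
    (tendsto_pow_atTop_nhds_zero_of_lt_one (r := (1 / 2 : ℝ)) (by norm_num) (by norm_num))
  have h1 := P.tower_le_one n
  have h2 : (2 : ℝ) ^ n ≤ P.h n := by exact_mod_cast P.two_pow_le_h n
  have h3 := mul_le_mul_of_nonneg_right h2 (measureReal_nonneg (μ := μ) (s := P.base n))
  rw [one_div, inv_pow, ← one_div, le_div_iff₀ (by positivity)]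
  linarith

/-- A level with index outside `J` is almost disjoint from all levels indexed by `J`, hence from the
base of stage `m`; having positive measure, it cannot be contained in that base. -/
theorem I_eq {m n : ℕ} {J : Finset ℕ} (hJ : ∀ c ∈ J, c < P.h n)
    (hB : ∀ᵐ x ∂μ, x ∈ P.base m ↔ ∃ c ∈ J, x ∈ P.level n c) : P.I m n = J := by
  ext i
  simp only [I, Finset.mem_filter, Finset.mem_range]
  constructor
  · rintro ⟨hi, h⟩
    by_contra hiJ
    have h2 : ∀ᵐ x ∂μ, ∀ c ∈ J, x ∈ P.level n i → x ∉ P.level n c := by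
      refine (ae_ball_iff J.countable_toSet).2 fun c hc => ?_
      have hic : i ≠ c := fun h => hiJ (h ▸ hc)
      have := P.aedisjoint_level hi (hJ c hc) hic
      filter_upwards [measure_eq_zero_iff_ae_notMem.1 this] with x hx h1 h2
      exact hx ⟨h1, h2⟩
    have h3 : ∀ᵐ x ∂μ, x ∉ P.level n i := by
      filter_upwards [h2, hB, h, (P.level_ae_eq n i).mem_iff, (P.base_ae_eq m).mem_iff]
        with x a b c d e hx
      obtain ⟨c', hc', hxc⟩ := b.1 (e.2 (c (d.1 hx)))
      exact a c' hc' hx hxc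
    have h4 : μ.real (P.level n i) = 0 := by
      simp [measureReal_def, measure_eq_zero_iff_ae_notMem.2 h3]
    rw [measureReal_level] at h4
    exact (P.measureReal_base_pos n).ne' h4
  · intro hi
    refine ⟨hJ i hi, ?_⟩
    filter_upwards [hB, (P.level_ae_eq n i).mem_iff, (P.base_ae_eq m).mem_iff] with x b d e hx
    exact e.1 (b.2 ⟨i, hi, d.2 hx⟩)

theorem add_h_le_of_mem_I {m n c : ℕ} (hmn : m ≤ n) (hc : c ∈ P.I m n) : c + P.h m ≤ P.h n := by
  obtain ⟨J, -, hJ, hB⟩ := P.exists_base_eq_levels hmn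
  have := P.h_pos m
  rw [P.I_eq (fun c hc => by have := hJ c hc; omega) hB] at hc
  exact hJ c hc

theorem ae_mem_level_iff {m n : ℕ} (hmn : m ≤ n) :
    ∀ᵐ x ∂μ, ∀ i, x ∈ P.level m i ↔ ∃ c ∈ P.I m n, x ∈ P.level n (i + c) := by
  obtain ⟨J, -, hJ, hB⟩ := P.exists_base_eq_levels hmn
  have := P.h_pos m
  rw [P.I_eq (fun c hc => by have := hJ c hc; omega) hB]
  exact ae_all_iff.2 (P.ae_mem_level_add_iff hB)

theorem card_I_mul {m n : ℕ} (hmn : m ≤ n) :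
    (P.I m n).card * μ.real (P.base n) = μ.real (P.base m) := by
  refine (P.measureReal_base_eq (fun c hc => P.lt_h_of_mem_I hc) ?_).symm
  filter_upwards [P.ae_mem_level_iff hmn] with x hx
  simpa [level, T.image_zero] using hx 0

theorem card_I_pos {m n : ℕ} (hmn : m ≤ n) : (0 : ℝ) < (P.I m n).card := by
  have h1 := P.card_I_mul hmn
  have h2 := P.measureReal_base_pos m
  rw [← h1] at h2
  exact pos_of_mul_pos_left h2 measureReal_nonneg

/-- An approximation at one stage persists, because every level splits into levels of any later
stage. -/
theorem eventually_levels_approx {A : Set X} (hA : MeasurableSet A) {ε : ℝ} (hε : 0 < ε) :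
    ∀ᶠ n in atTop, ∃ J ⊆ Finset.range (P.h n), μ.real (A ∆ P.levels n J) < ε := by
  obtain ⟨m, J, hJ, h⟩ := P.exists_levels_approx hA hε
  filter_upwards [eventually_ge_atTop m] with n hmn
  refine ⟨Finset.image₂ (· + ·) J (P.I m n), ?_, ?_⟩
  · intro c hc
    simp only [Finset.mem_image₂] at hc
    obtain ⟨a, ha, b, hb, rfl⟩ := hc
    have := P.add_h_le_of_mem_I hmn hb
    have := Finset.mem_range.1 (hJ ha)
    simp
    omega
  · have h1 : P.levels m J =ᵐ[μ] P.levels n (Finset.image₂ (· + ·) J (P.I m n)) := by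
      refine eventuallyEq_set.2 ?_
      filter_upwards [P.ae_mem_level_iff hmn] with x hx
      simp only [mem_levels, hx, Finset.mem_image₂]
      constructor
      · rintro ⟨i, hi, c, hc, h⟩
        exact ⟨_, ⟨i, hi, c, hc, rfl⟩, h⟩
      · rintro ⟨_, ⟨i, hi, c, hc, rfl⟩, h⟩
        exact ⟨i, hi, c, hc, h⟩
    rwa [measureReal_congr ((ae_eq_refl A).symmDiff h1)] at h

end RankOnePresentation

/-! ### The algebra of cylinders of the odometer. -/

namespace OdometerSequence

variable (κ : OdometerSequence)

/-- The set of all points of the odometer whose `n`-th coordinate lies in `D`. -/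
def cylinder (n : ℕ) (D : Set (ZMod (κ.k n))) : Set κ.space :=
  {α | (α : ∀ n, ZMod (κ.k n)) n ∈ D}

/-- The algebra of all cylinders. -/
def cylinders : Set (Set κ.space) := {G | ∃ n D, G = κ.cylinder n D}

theorem measurable_coord (n : ℕ) :
    Measurable fun α : κ.space => (α : ∀ n, ZMod (κ.k n)) n :=
  (measurable_pi_apply n).comp measurable_subtype_coe

theorem measurableSet_cylinder (n : ℕ) (D : Set (ZMod (κ.k n))) :
    MeasurableSet (κ.cylinder n D) :=
  κ.measurable_coord n (MeasurableSet.of_discrete (s := D))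

theorem exists_cylinder_eq_of_le {m n : ℕ} (h : m ≤ n) (D : Set (ZMod (κ.k m))) :
    ∃ D' : Set (ZMod (κ.k n)), κ.cylinder m D = κ.cylinder n D' := by
  refine ⟨ZMod.castHom (κ.dvd h) (ZMod (κ.k m)) ⁻¹' D, ?_⟩
  ext α
  simp only [cylinder, Set.mem_ofPred_eq, Set.mem_preimage]
  rw [α.2 m n h]

theorem isSetAlgebra_cylinders : IsSetAlgebra κ.cylinders where
  empty_mem := ⟨0, ∅, by simp [cylinder]⟩
  compl_mem := by
    rintro _ ⟨n, D, rfl⟩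
    exact ⟨n, Dᶜ, rfl⟩
  union_mem := by
    rintro _ _ ⟨n, D, rfl⟩ ⟨n', D', rfl⟩
    obtain ⟨E, hE⟩ := κ.exists_cylinder_eq_of_le (le_max_left n n') D
    obtain ⟨E', hE'⟩ := κ.exists_cylinder_eq_of_le (le_max_right n n') D'
    exact ⟨max n n', E ∪ E', by rw [hE, hE']; rfl⟩

theorem generateFrom_cylinders :
    (inferInstance : MeasurableSpace κ.space) = MeasurableSpace.generateFrom κ.cylinders := by
  refine le_antisymm ?_ (MeasurableSpace.generateFrom_le ?_)
  · rintro _ ⟨s, hs, rfl⟩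
    have : Measurable[MeasurableSpace.generateFrom κ.cylinders]
        (fun α : κ.space => (α : ∀ n, ZMod (κ.k n))) := by
      refine (@measurable_pi_iff _ _ _ (MeasurableSpace.generateFrom κ.cylinders) _ _).2 fun n => ?_
      intro D _
      exact MeasurableSpace.measurableSet_generateFrom ⟨n, D, rfl⟩
    exact this hs
  · rintro _ ⟨n, D, rfl⟩
    exact κ.measurableSet_cylinder n D

theorem exists_cylinder_approx {G : Set κ.space} (hG : MeasurableSet G) {ε : ℝ} (hε : 0 < ε) :
    ∃ n D, κ.measure.real (G ∆ κ.cylinder n D) < ε := by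
  have h := Measure.MeasureDense.of_generateFrom_isSetAlgebra_finite κ.measure
    κ.isSetAlgebra_cylinders κ.generateFrom_cylinders
  obtain ⟨_, ⟨n, D, rfl⟩, h⟩ := h.approx G hG (measure_ne_top _ _) ε hε
  exact ⟨n, D, (ENNReal.lt_ofReal_iff_toReal_lt (measure_ne_top _ _)).1 h⟩

theorem coe_add_one (α : κ.space) (n : ℕ) :
    ((α + κ.one : κ.space) : ∀ n, ZMod (κ.k n)) n = (α : ∀ n, ZMod (κ.k n)) n + 1 := rfl

end OdometerSequence

/-! ### Equivariant maps to cyclic groups, and the residue conditions derived from an isomorphism.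
-/

namespace MPTransformation

variable {X : Type*} [MeasurableSpace X] {μ : Measure X} {T : MPTransformation μ}

theorem ae_eq_add_of_cyclic {k : ℕ} {f : X → ZMod k} (hT : ∀ᵐ x ∂μ, f (T.toFun x) = f x + 1) :
    ∀ᵐ x ∂μ, ∀ i : ℕ, f x = f (T.invFun^[i] x) + i := by
  have h1 : ∀ᵐ x ∂μ, f x = f (T.invFun x) + 1 := by
    filter_upwards [T.measurePreserving_inv.quasiMeasurePreserving.ae hT, T.right_inv] with x h1 h2
    rwa [h2] at h1
  have h2 : ∀ᵐ x ∂μ, ∀ i : ℕ, f (T.invFun^[i] x) = f (T.invFun (T.invFun^[i] x)) + 1 :=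
    ae_all_iff.2 fun i => (T.measurePreserving_inv.iterate i).quasiMeasurePreserving.ae h1
  filter_upwards [h2] with x hx i
  induction i with
  | zero => simp
  | succ i ih =>
    rw [ih, hx i, Function.iterate_succ_apply']
    push_cast
    ring

end MPTransformation

namespace RankOnePresentation

variable {X : Type*} [MeasurableSpace X] {μ : Measure X} {T : MPTransformation μ}
  (P : RankOnePresentation T)

section cyclic

variable {k : ℕ} {f : X → ZMod k}

theorem measureReal_level_inter (hf : Measurable f) (hT : ∀ᵐ x ∂μ, f (T.toFun x) = f x + 1)
    (n i : ℕ) (D : Set (ZMod k)) :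
    μ.real (P.level n i ∩ {x | f x - i ∈ D}) = μ.real (P.base n ∩ {x | f x ∈ D}) := by
  have hm : MeasurableSet {x | f x ∈ D} := hf (MeasurableSet.of_discrete (s := D))
  rw [← T.measureReal_image i ((P.measurableSet_base n).inter hm)]
  refine measureReal_congr (eventuallyEq_set.2 ?_)
  filter_upwards [MPTransformation.ae_eq_add_of_cyclic hT] with x hx
  have : f x - i = f (T.invFun^[i] x) := by rw [hx i, add_sub_cancel_right]
  simp [level, MPTransformation.image, this]

variable [IsProbabilityMeasure μ]

/-- Each of the finitely many fibres of `f` is close to a union of levels, so sending a level to a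
fibre whose approximation contains it is wrong only on the union of the symmetric differences. -/
theorem exists_level_function [NeZero k] (hf : Measurable f) {ε : ℝ} (hε : 0 < ε) :
    ∀ᶠ n in atTop, ∃ a : ℕ → ZMod k,
      ∑ i ∈ Finset.range (P.h n), μ.real (P.level n i ∩ {x | f x ≠ a i}) < ε := by
  have hk : (0 : ℝ) < k := by exact_mod_cast NeZero.pos k
  have hm : ∀ D : Set (ZMod k), MeasurableSet {x | f x ∈ D} := fun D =>
    hf (MeasurableSet.of_discrete (s := D))
  have happ : ∀ᶠ n in atTop, ∀ j : ZMod k, ∃ J ⊆ Finset.range (P.h n),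
      μ.real ({x | f x = j} ∆ P.levels n J) < ε / k :=
    eventually_all.2 fun j => P.eventually_levels_approx (hm {j}) (by positivity)
  filter_upwards [happ] with n hn
  choose E hEs hE using hn
  classical
  -- The default `0` is immaterial: if no `E j` contains `i`, every point of level `i` already lies
  -- in the symmetric difference belonging to its own value of `f`, up to a null set.
  let a : ℕ → ZMod k := fun i => if h : ∃ j, i ∈ E j then h.choose else 0
  refine ⟨a, ?_⟩
  rw [← measureReal_biUnion_finset₀]
  · calc μ.real (⋃ i ∈ Finset.range (P.h n), P.level n i ∩ {x | f x ≠ a i})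
        ≤ μ.real (⋃ j ∈ (Finset.univ : Finset (ZMod k)), {x | f x = j} ∆ P.levels n (E j)) := by
          refine ENNReal.toReal_mono (measure_ne_top _ _) (measure_mono_ae ?_)
          filter_upwards [P.ae_eq_of_mem_level n] with x hx hx'
          obtain ⟨i, hi, hxi, hfx⟩ := Set.mem_iUnion₂.1 hx'
          rw [Finset.mem_range] at hi
          suffices ∃ j, x ∈ ({x | f x = j} ∆ P.levels n (E j) : Set X) from
            Set.mem_iUnion₂.2 (by simpa using this)
          simp only [Set.mem_symmDiff, Set.mem_ofPred_eq, mem_levels]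
          by_cases hi' : i ∈ E (f x)
          · have hex : ∃ j, i ∈ E j := ⟨_, hi'⟩
            have ha : a i = hex.choose := dif_pos hex
            exact ⟨a i, .inr ⟨⟨i, ha ▸ hex.choose_spec, hxi⟩, hfx⟩⟩
          · refine ⟨f x, .inl ⟨rfl, ?_⟩⟩
            rintro ⟨c, hc, hxc⟩
            exact hi' (hx i hi c (Finset.mem_range.1 (hEs _ hc)) hxi hxc ▸ hc)
      _ ≤ ∑ j : ZMod k, μ.real ({x | f x = j} ∆ P.levels n (E j)) :=
          measureReal_biUnion_finset_le _ _
      _ < ∑ j : ZMod k, ε / k :=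
          Finset.sum_lt_sum_of_nonempty Finset.univ_nonempty fun j _ => hE j
      _ = ε := by
          rw [Finset.sum_const, Finset.card_univ, ZMod.card, nsmul_eq_mul]
          field_simp
  · intro i hi j hj hij
    exact (P.aedisjoint_level (by simpa using hi) (by simpa using hj) hij).mono
      Set.inter_subset_left Set.inter_subset_left
  · intro i _
    exact ((P.measurableSet_level n i).inter (hm {a i}ᶜ)).nullMeasurableSet

/-- By equivariance, the distribution of `f` on level `i` is that on the base shifted by `i`. If the
base were spread out, every level would be equally so, and no choice of constants on levels could
approximate `f`. -/
theorem eventually_base_concentrated [NeZero k] (hf : Measurable f)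
    (hT : ∀ᵐ x ∂μ, f (T.toFun x) = f x + 1) {η : ℝ} (hη : 0 < η) :
    ∀ᶠ n in atTop, ∃ j, μ.real (P.base n ∩ {x | f x ≠ j}) ≤ η * μ.real (P.base n) := by
  have h1 : ∀ᶠ n in atTop, 1 / 2 < P.h n * μ.real (P.base n) :=
    P.tendsto_tower.eventually (lt_mem_nhds (by norm_num))
  filter_upwards [h1, P.exists_level_function hf (half_pos hη)] with n h1 ⟨a, ha⟩
  by_contra! hcon
  have h2 : ∀ i, η * μ.real (P.base n) ≤ μ.real (P.level n i ∩ {x | f x ≠ a i}) := by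
    intro i
    have h3 := P.measureReal_level_inter hf hT n i {a i - i}ᶜ
    simp only [Set.mem_compl_iff, Set.mem_singleton_iff, sub_left_inj] at h3
    exact (hcon (a i - i)).le.trans h3.ge
  have h3 := Finset.sum_le_sum fun i (_ : i ∈ Finset.range (P.h n)) => h2 i
  rw [Finset.sum_const, Finset.card_range, nsmul_eq_mul] at h3
  nlinarith

theorem card_mul_le_of_concentrated (hf : Measurable f)
    (hT : ∀ᵐ x ∂μ, f (T.toFun x) = f x + 1) {n : ℕ} {j : ZMod k} {δ : ℝ}
    (hj : μ.real (P.base n ∩ {x | f x ≠ j}) ≤ δ * μ.real (P.base n))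
    {S : Finset ℕ} (hS : ∀ i ∈ S, i < P.h n) {E : Set X}
    (hE : ∀ᵐ x ∂μ, ∀ i ∈ S, x ∈ P.level n i → f x = i + j → x ∈ E) :
    S.card * ((1 - δ) * μ.real (P.base n)) ≤ μ.real E := by
  have hm : ∀ D : Set (ZMod k), MeasurableSet {x | f x ∈ D} := fun D =>
    hf (MeasurableSet.of_discrete (s := D))
  have h1 : ∀ i : ℕ, (1 - δ) * μ.real (P.base n) ≤
      μ.real (P.level n i ∩ {x | f x - i ∈ ({j} : Set (ZMod k))}) := by
    intro i
    rw [P.measureReal_level_inter hf hT]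
    have h2 := measureReal_inter_add_sdiff (μ := μ) (s := P.base n) (hm {j})
    have h3 : P.base n \ {x | f x ∈ ({j} : Set (ZMod k))} = P.base n ∩ {x | f x ≠ j} := rfl
    rw [h3] at h2
    linarith
  have h2 := Finset.sum_le_sum fun i (_ : i ∈ S) => h1 i
  rw [Finset.sum_const, nsmul_eq_mul, ← measureReal_biUnion_finset₀] at h2
  · refine h2.trans (ENNReal.toReal_mono (measure_ne_top _ _) (measure_mono_ae ?_))
    filter_upwards [hE] with x hx hx'
    obtain ⟨i, hi, hxi, hfx⟩ := Set.mem_iUnion₂.1 hx'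
    rw [Set.mem_ofPred_eq, Set.mem_singleton_iff] at hfx
    exact hx i hi hxi (by rw [← hfx]; ring)
  · intro a ha b hb hab
    exact (P.aedisjoint_level (hS a ha) (hS b hb) hab).mono
      Set.inter_subset_left Set.inter_subset_left
  · intro i _
    have : {x | f x - i ∈ ({j} : Set (ZMod k))} = {x | f x ∈ ({j + i} : Set (ZMod k))} := by
      ext x
      simp [sub_eq_iff_eq_add]
    rw [this]
    exact ((P.measurableSet_level n i).inter (hm _)).nullMeasurableSet

theorem ae_mem_base_iff {m n : ℕ} (hmn : m ≤ n) :
    ∀ᵐ x ∂μ, ∀ i < P.h n, x ∈ P.level n i → (x ∈ P.base m ↔ i ∈ P.I m n) := by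
  filter_upwards [P.ae_mem_level_iff hmn, P.ae_eq_of_mem_level n] with x h1 h2 i hi hxi
  have h3 := h1 0
  simp only [level, T.image_zero, zero_add] at h3
  rw [h3]
  refine ⟨?_, fun h => ⟨i, h, hxi⟩⟩
  rintro ⟨c, hc, hxc⟩
  exact h2 i hi c (P.lt_h_of_mem_I hc) hxi hxc ▸ hc

theorem residues_concentrated [NeZero k] (hf : Measurable f)
    (hT : ∀ᵐ x ∂μ, f (T.toFun x) = f x + 1) {η : ℝ} (hη : 0 < η) :
    ∃ N : ℕ, ∀ m n : ℕ, N ≤ m → m ≤ n → ∃ j : ZMod k,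
      (((P.I m n).filter (fun i : ℕ => (i : ZMod k) ≠ j)).card : ℝ) / ((P.I m n).card : ℝ) < η := by
  -- The count `c` of exceptional indices will satisfy c(1 - δ) ≤ δ|I|, so that c ≤ 2δ|I| ≤
  -- (η/2)|I|.
  set δ := min (1 / 2) (η / 4) with hδ
  have hδ0 : 0 < δ := by positivity
  have hδ1 : δ ≤ 1 / 2 := min_le_left _ _
  have hδ2 : δ ≤ η / 4 := min_le_right _ _
  obtain ⟨N, hN⟩ := eventually_atTop.1 (P.eventually_base_concentrated hf hT hδ0)
  refine ⟨N, fun m n hm hmn => ?_⟩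
  obtain ⟨a, ha⟩ := hN m hm
  obtain ⟨b, hb⟩ := hN n (hm.trans hmn)
  refine ⟨a - b, ?_⟩
  have h1 := P.card_mul_le_of_concentrated hf hT hb
    (S := (P.I m n).filter (fun i : ℕ => (i : ZMod k) ≠ a - b))
    (E := P.base m ∩ {x | f x ≠ a})
    (fun i hi => P.lt_h_of_mem_I (Finset.mem_filter.1 hi).1) (by
      filter_upwards [P.ae_mem_base_iff hmn] with x hx i hi hxi hfx
      obtain ⟨hi1, hi2⟩ := Finset.mem_filter.1 hi
      refine ⟨(hx i (P.lt_h_of_mem_I hi1) hxi).2 hi1, fun h => hi2 ?_⟩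
      rw [← h, hfx, add_sub_cancel_right])
  have hI := P.card_I_pos hmn
  have hbn := P.measureReal_base_pos n
  rw [div_lt_iff₀ hI]
  rw [← P.card_I_mul hmn] at ha
  set c : ℝ := (((P.I m n).filter (fun i : ℕ => (i : ZMod k) ≠ a - b)).card : ℝ)
  have hc : 0 ≤ c := Nat.cast_nonneg _
  have h2 : c * (1 - δ) * μ.real (P.base n) ≤ δ * (P.I m n).card * μ.real (P.base n) := by
    linarith
  have h3 := le_of_mul_le_mul_right h2 hbn
  nlinarith

theorem base_approx_residues [NeZero k] (hf : Measurable f)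
    (hT : ∀ᵐ x ∂μ, f (T.toFun x) = f x + 1) {l : ℕ} {ε : ℝ} (hε : 0 < ε) {D : Set (ZMod k)}
    (hD : μ.real (P.base l ∆ {x | f x ∈ D}) < ε / 4 * μ.real (P.base l)) :
    ∃ N : ℕ, l ≤ N ∧ ∀ m : ℕ, N ≤ m → ∃ D : Finset (ZMod k),
      ((((Finset.range (P.h m + 1)).filter (fun i : ℕ => (i : ZMod k) ∈ D)) ∆
        P.I l m).card : ℝ) / ((P.I l m).card : ℝ) < ε := by
  classical
  have hbl := P.measureReal_base_pos l
  have h1 : ∀ᶠ n in atTop, μ.real (P.base n) < ε / 2 * μ.real (P.base l) :=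
    P.tendsto_measureReal_base.eventually (gt_mem_nhds (by positivity))
  obtain ⟨N, hN⟩ := eventually_atTop.1
    (((P.eventually_base_concentrated hf hT (η := 1 / 2) (by norm_num)).and h1).and
      (eventually_ge_atTop l))
  refine ⟨N, (hN N le_rfl).2, fun m hm => ?_⟩
  obtain ⟨⟨⟨j, hj⟩, hbm⟩, hlm⟩ := hN m hm
  -- On at least half of level `i` the value of `f` is `i + j`, so the test `f x ∈ D` becomes a test
  -- on the residue of `i`.
  refine ⟨Finset.univ.filter fun d => d + j ∈ D, ?_⟩
  set S := (Finset.range (P.h m)).filter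
    (fun i : ℕ => (i : ZMod k) ∈ Finset.univ.filter fun d => d + j ∈ D) ∆ P.I l m with hSdef
  have h2 := P.card_mul_le_of_concentrated hf hT hj (S := S)
    (E := P.base l ∆ {x | f x ∈ D}) (fun i hi => by
      rcases Finset.mem_symmDiff.1 hi with h | h
      · exact Finset.mem_range.1 (Finset.mem_filter.1 h.1).1
      · exact P.lt_h_of_mem_I h.1) (by
      filter_upwards [P.ae_mem_base_iff hlm] with x hx i hi hxi hfx
      rcases Finset.mem_symmDiff.1 hi with ⟨h, h'⟩ | ⟨h, h'⟩
      · obtain ⟨ha, hb⟩ := Finset.mem_filter.1 h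
        rw [Finset.mem_filter] at hb
        refine .inr ⟨?_, fun h => h' ((hx i (Finset.mem_range.1 ha) hxi).1 h)⟩
        rw [Set.mem_ofPred_eq, hfx]
        exact hb.2
      · have hi := P.lt_h_of_mem_I h
        refine .inl ⟨(hx i hi hxi).2 h, fun hD => h' ?_⟩
        rw [Set.mem_ofPred_eq, hfx] at hD
        simp [hi, hD])
  -- The range includes the index `h m`, which is not a level of the tower. It adds at most one
  -- element, and 1 < (ε/2)|I| by the choice of `N`.
  have h3 : ((Finset.range (P.h m + 1)).filter
      (fun i : ℕ => (i : ZMod k) ∈ Finset.univ.filter fun d => d + j ∈ D)) ∆ P.I l m ⊆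
      insert (P.h m) S := by
    intro i hi
    simp only [hSdef, Finset.mem_insert, Finset.mem_symmDiff, Finset.mem_filter, Finset.mem_range]
      at hi ⊢
    have : i < P.h m + 1 → i = P.h m ∨ i < P.h m := by omega
    tauto
  have h4 := (Finset.card_le_card h3).trans (Finset.card_insert_le _ _)
  rw [div_lt_iff₀ (P.card_I_pos hlm)]
  refine lt_of_le_of_lt (Nat.cast_le.2 h4) ?_
  push_cast
  have h6 := P.card_I_mul hlm
  rw [← h6] at hbm hD
  have hpos := P.measureReal_base_pos m
  refine lt_of_mul_lt_mul_right ?_ hpos.le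
  linarith

end cyclic

theorem residues_of_isomorphic [IsProbabilityMeasure μ] {κ : OdometerSequence}
    (hiso : T.Isomorphic κ.odometer) :
    (∀ k ∈ κ.factors, ∀ η : ℝ, 0 < η → ∃ N : ℕ, ∀ m n : ℕ, N ≤ m → m ≤ n → ∃ j : ZMod k,
      (((P.I m n).filter (fun i : ℕ => (i : ZMod k) ≠ j)).card : ℝ) /
        ((P.I m n).card : ℝ) < η) ∧
    (∀ l : ℕ, ∀ ε : ℝ, 0 < ε → ∃ k ∈ κ.factors, ∃ N : ℕ, l ≤ N ∧ ∀ m : ℕ, N ≤ m →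
      ∃ D : Finset (ZMod k),
        ((((Finset.range (P.h m + 1)).filter (fun i : ℕ => (i : ZMod k) ∈ D)) ∆
            P.I l m).card : ℝ) / ((P.I l m).card : ℝ) < ε) := by
  obtain ⟨φ, ψ, ⟨hφ, hφT⟩, hψ, hψφ, hφψ⟩ := hiso
  constructor
  · rintro k ⟨n, hk⟩ η hη
    have : NeZero k := ⟨by rintro rfl; exact NeZero.ne (κ.k n) (zero_dvd_iff.1 hk)⟩
    refine P.residues_concentrated (f := fun x => ZMod.castHom hk (ZMod k) ((φ x).1 n))
      ((Measurable.of_discrete).comp ((κ.measurable_coord n).comp hφ.measurable)) ?_ hη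
    filter_upwards [hφT] with x hx
    rw [hx]
    exact (map_add _ _ _).trans (congrArg _ (map_one (ZMod.castHom hk (ZMod k))))
  · intro l ε hε
    have hbl := P.measureReal_base_pos l
    -- The preimage of the base under `ψ` is a subset of the odometer, where cylinders are dense;
    -- `φ` then pulls the approximation back.
    have hG := hψ.measurable (P.measurableSet_base l)
    obtain ⟨n, D, hD⟩ := κ.exists_cylinder_approx hG
      (show 0 < ε / 4 * μ.real (P.base l) by positivity)
    refine ⟨κ.k n, ⟨n, dvd_rfl⟩, P.base_approx_residues (f := fun x => (φ x).1 n)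
      ((κ.measurable_coord n).comp hφ.measurable) ?_ hε (D := D) ?_⟩
    · filter_upwards [hφT] with x hx
      rw [hx]
      rfl
    · rw [← hφ.measureReal_preimage
        ((hG.symmDiff (κ.measurableSet_cylinder n D)).nullMeasurableSet)] at hD
      refine (measureReal_congr (eventuallyEq_set.2 ?_)).trans_lt hD
      filter_upwards [hψφ] with x hx
      simp [Set.mem_symmDiff, hx, OdometerSequence.cylinder]

end RankOnePresentation

/-! ### Preimages modulo null sets and almost everywhere inverses. -/

theorem MeasureTheory.ae_eventually_notMem_of_measureReal_le_geometric {X : Type*}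
    [MeasurableSpace X] {μ : Measure X} [IsFiniteMeasure μ] {E : ℕ → Set X}
    (hE : ∀ t, μ.real (E t) ≤ (1 / 2) ^ t) : ∀ᵐ x ∂μ, ∀ᶠ t in atTop, x ∉ E t := by
  refine ae_eventually_notMem (ne_top_of_le_ne_top summable_geometric_two.tsum_ofReal_ne_top
    (ENNReal.tsum_le_tsum fun t => ?_))
  rw [← ofReal_measureReal]
  exact ENNReal.ofReal_le_ofReal (hE t)

/-- If `A` is approximated in measure by preimages of measurable sets, then it is itself such a
preimage, up to a null set. -/
theorem MeasureTheory.exists_preimage_of_approx {X Y : Type*} [MeasurableSpace X]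
    [MeasurableSpace Y] {μ : Measure X} [IsFiniteMeasure μ] {φ : X → Y} {A : Set X}
    (h : ∀ ε : ℝ, 0 < ε → ∃ G, MeasurableSet G ∧ μ.real (A ∆ (φ ⁻¹' G)) < ε) :
    ∃ G, MeasurableSet G ∧ ∀ᵐ x ∂μ, x ∈ A ↔ φ x ∈ G := by
  choose G hG hA using fun t : ℕ => h ((1 / 2) ^ t) (by positivity)
  -- The errors are summable, so by Borel–Cantelli membership of `φ x` in `G t` eventually agrees
  -- with membership of `x` in `A`.
  refine ⟨limsup G atTop, MeasurableSet.measurableSet_limsup hG, ?_⟩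
  filter_upwards [ae_eventually_notMem_of_measureReal_le_geometric fun t => (hA t).le] with x hx
  have h1 : ∀ᶠ t in atTop, (φ x ∈ G t ↔ x ∈ A) := by
    filter_upwards [hx] with t ht
    simp only [Set.mem_symmDiff, Set.mem_preimage] at ht
    tauto
  rw [mem_limsup_iff_frequently_mem, frequently_congr h1]
  simp

/-- A measure-preserving map on a standard Borel space that generates the `σ`-algebra up to null
sets is invertible almost everywhere. -/
theorem MeasureTheory.MeasurePreserving.exists_ae_inverse {X Y : Type*} [MeasurableSpace X]
    [StandardBorelSpace X] [Nonempty X] [MeasurableSpace Y] [MeasurableEq Y]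
    {μ : Measure X} {ν : Measure Y} {φ : X → Y} (hφ : MeasurePreserving φ μ ν)
    (h : ∀ A, MeasurableSet A → ∃ G, MeasurableSet G ∧ ∀ᵐ x ∂μ, x ∈ A ↔ φ x ∈ G) :
    ∃ ψ : Y → X, MeasurePreserving ψ ν μ ∧ (∀ᵐ x ∂μ, ψ (φ x) = x) ∧ ∀ᵐ y ∂ν, φ (ψ y) = y := by
  classical
  have he := MeasurableSpace.measurable_mapNatBool X
  have hemb := he.measurableEmbedding (MeasurableSpace.injective_mapNatBool X)
  -- `d` is a measurable left inverse of the embedding of `X` into binary sequences. The sets `G n`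
  -- below let the code of `x` be read off from `φ x`, and `d` decodes it.
  obtain ⟨d, hd, hde⟩ := hemb.exists_measurable_extend measurable_id fun _ => ‹Nonempty X›
  choose G hG hGA using fun n : ℕ =>
    h _ (((measurable_pi_apply n).comp he) (MeasurableSet.singleton true))
  let g : Y → ℕ → Bool := fun y n => decide (y ∈ G n)
  have hg : Measurable g := measurable_pi_iff.2 fun n =>
    measurable_to_bool (by
      have : (fun y => g y n) ⁻¹' {true} = G n := by ext y; simp [g]
      rw [this]
      exact hG n)
  have hψφ : ∀ᵐ x ∂μ, d (g (φ x)) = x := by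
    filter_upwards [ae_all_iff.2 hGA] with x hx
    have : g (φ x) = MeasurableSpace.mapNatBool X x := by
      funext n
      have := hx n
      simp only [Set.mem_preimage, Function.comp_apply, Set.mem_singleton_iff] at this
      rw [Bool.eq_iff_iff, this]
      simp [g]
    rw [this]
    exact congrFun hde x
  have hm : Measurable fun y => d (g y) := hd.comp hg
  refine ⟨fun y => d (g y), ⟨hm, ?_⟩, hψφ, ?_⟩
  · rw [← hφ.map_eq, Measure.map_map hm hφ.measurable]
    exact (Measure.map_congr hψφ).trans Measure.map_id
  · rw [← hφ.map_eq]
    refine (ae_map_iff hφ.measurable.aemeasurable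
      (measurableSet_eq_fun (hφ.measurable.comp hm) measurable_id)).2 ?_
    filter_upwards [hψφ] with x hx
    exact congrArg φ hx

/-! ### Limits in the odometer and equivariant maps into it. -/

namespace OdometerSequence

variable (κ : OdometerSequence)

instance : SecondCountableTopology κ.space :=
  inferInstanceAs (SecondCountableTopology (κ.space : Set (∀ n, ZMod (κ.k n))))

theorem coe_zsmul_one (z : ℤ) (n : ℕ) :
    ((z • κ.one : κ.space) : ∀ n, ZMod (κ.k n)) n = z := by
  simp [one]

theorem exists_tendsto_zsmul_one {F : ℕ → ℤ}
    (hF : ∀ᶠ t in atTop, (F (t + 1) : ZMod (κ.k t)) = F t) :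
    ∃ α : κ.space, Tendsto (fun t => F t • κ.one) atTop (𝓝 α) := by
  obtain ⟨t₀, ht₀⟩ := eventually_atTop.1 hF
  have hcast : ∀ {m n : ℕ} (h : m ≤ n) (z : ℤ),
      ZMod.castHom (κ.dvd h) (ZMod (κ.k m)) (z : ZMod (κ.k n)) = z := fun h z => map_intCast _ z
  -- A congruence modulo `k t` implies one modulo `k n` when `n ≤ t`, so each coordinate is constant
  -- from `max t₀ n` on.
  have hstep : ∀ n t, max t₀ n ≤ t → (F t : ZMod (κ.k n)) = F (max t₀ n) := by
    intro n t ht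
    induction t, ht using Nat.le_induction with
    | base => rfl
    | succ t ht ih =>
      have hn : n ≤ t := (le_max_right _ _).trans ht
      rw [← ih, ← hcast hn, ht₀ t ((le_max_left _ _).trans ht), hcast hn]
  refine ⟨⟨fun n => F (max t₀ n), fun m n h => ?_⟩, ?_⟩
  · rw [hcast h]
    exact hstep m _ (max_le_max le_rfl h)
  · rw [tendsto_subtype_rng, tendsto_pi_nhds]
    intro n
    refine tendsto_const_nhds.congr' ?_
    filter_upwards [eventually_ge_atTop (max t₀ n)] with t ht
    rw [coe_zsmul_one, hstep n t ht]

theorem eventually_coord_eq {F : ℕ → ℤ} {α : κ.space}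
    (h : Tendsto (fun t => F t • κ.one) atTop (𝓝 α)) (n : ℕ) :
    ∀ᶠ t in atTop, (F t : ZMod (κ.k n)) = (α : ∀ n, ZMod (κ.k n)) n := by
  rw [tendsto_subtype_rng, tendsto_pi_nhds] at h
  have h1 := h n
  rw [nhds_discrete, tendsto_pure] at h1
  simpa only [coe_zsmul_one] using h1

/-- Invariance of `μ` under `T` gives all fibres of a coordinate equal measure, hence `1 / k n`.
Thus the image measure agrees with Haar measure on cylinders, which form a generating π-system. -/
theorem measurePreserving_of_equivariant {X : Type*} [MeasurableSpace X] {μ : Measure X}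
    [IsProbabilityMeasure μ] {T : MPTransformation μ} {φ : X → κ.space} (hφ : Measurable φ)
    (hT : ∀ᵐ x ∂μ, φ (T.toFun x) = φ x + κ.one) : MeasurePreserving φ μ κ.measure := by
  have hone : ∀ n (i : ZMod (κ.k n)), μ {x | (φ x).1 n = i} = (κ.k n : ℝ≥0∞)⁻¹ := by
    intro n
    have hm : ∀ i, MeasurableSet {x | (φ x).1 n = i} := fun i =>
      ((κ.measurable_coord n).comp hφ) (MeasurableSet.singleton i)
    have h1 : ∀ i, μ {x | (φ x).1 n = i + 1} = μ {x | (φ x).1 n = i} := by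
      intro i
      rw [← T.measurePreserving.measure_preimage (hm (i + 1)).nullMeasurableSet]
      refine measure_congr (eventuallyEq_set.2 ?_)
      filter_upwards [hT] with x hx
      simp only [Set.mem_preimage, Set.mem_ofPred_eq, hx, coe_add_one, add_left_inj]
    have h2 : ∀ a : ℕ, μ {x | (φ x).1 n = a} = μ {x | (φ x).1 n = 0} := by
      intro a
      induction a with
      | zero => simp
      | succ a ih => rw [← ih, Nat.cast_succ, h1]
    have h3 : ∀ i, μ {x | (φ x).1 n = i} = μ {x | (φ x).1 n = 0} := fun i => by
      rw [← h2 i.val, ZMod.natCast_zmod_val]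
    have hsum : ∑ i : ZMod (κ.k n), μ {x | (φ x).1 n = i} = 1 := by
      rw [← measure_univ (μ := μ), ← measure_biUnion_finset]
      · congr 1
        ext x
        simp
      · intro a _ b _ hab
        exact Set.disjoint_left.mpr fun x ha hb => hab (ha.symm.trans hb)
      · exact fun i _ => hm i
    intro i
    simp only [h3, Finset.sum_const, Finset.card_univ, ZMod.card, nsmul_eq_mul] at hsum
    rw [h3 i]
    exact ENNReal.eq_inv_of_mul_eq_one_left (by rwa [mul_comm])
  have : IsProbabilityMeasure (μ.map φ) := Measure.isProbabilityMeasure_map hφ.aemeasurable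
  refine ⟨hφ, ext_of_generate_finite κ.cylinders κ.generateFrom_cylinders
    κ.isSetAlgebra_cylinders.isSetRing.isSetSemiring.isPiSystem ?_ (by simp)⟩
  rintro _ ⟨n, D, rfl⟩
  have hcoord : (μ.map φ).map (fun α : κ.space => α.1 n) =
      κ.measure.map (fun α : κ.space => α.1 n) := by
    refine Measure.ext_of_singleton fun i => ?_
    rw [Measure.map_apply (κ.measurable_coord n) (MeasurableSet.singleton i),
      Measure.map_apply (κ.measurable_coord n) (MeasurableSet.singleton i),
      Measure.map_apply hφ (κ.measurable_coord n (MeasurableSet.singleton i))]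
    exact (hone n i).trans (κ.measure_cylinder n i).symm
  have h4 := DFunLike.congr_fun hcoord D
  rwa [Measure.map_apply (κ.measurable_coord n) MeasurableSet.of_discrete,
    Measure.map_apply (κ.measurable_coord n) MeasurableSet.of_discrete] at h4

end OdometerSequence

/-! ### The isomorphism constructed from the residue conditions. -/

namespace RankOnePresentation

variable {X : Type*} [MeasurableSpace X] {μ : Measure X} {T : MPTransformation μ}
  (P : RankOnePresentation T)

/-- The index of the level of the stage-`n` tower that contains the given point (zero outside the
tower). -/
noncomputable def index (n : ℕ) (x : X) : ℕ :=
  ∑ i ∈ Finset.range (P.h n), (P.level n i).indicator (fun _ => i) x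

theorem measurable_index (n : ℕ) : Measurable (P.index n) :=
  Finset.measurable_fun_sum _ fun i _ => measurable_const.indicator (P.measurableSet_level n i)

theorem ae_index_eq (n : ℕ) : ∀ᵐ x ∂μ, ∀ i < P.h n, x ∈ P.level n i → P.index n x = i := by
  filter_upwards [P.ae_eq_of_mem_level n] with x hx i hi hxi
  rw [index, Finset.sum_eq_single_of_mem i (Finset.mem_range.2 hi), Set.indicator_of_mem hxi]
  intro j hj hji
  exact Set.indicator_of_notMem (fun hxj => hji (hx j (Finset.mem_range.1 hj) i hi hxj hxi)) _

theorem ae_toFun_mem_level (n : ℕ) :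
    ∀ᵐ x ∂μ, ∀ i, x ∈ P.level n i → T.toFun x ∈ P.level n (i + 1) := by
  filter_upwards [T.left_inv] with x hx i hi
  simpa only [level, MPTransformation.image, Set.mem_preimage, Function.iterate_succ_apply, hx]
    using hi

variable [IsProbabilityMeasure μ]

theorem tendsto_interior :
    Tendsto (fun n => ((P.h n - 1 : ℕ) : ℝ) * μ.real (P.base n)) atTop (𝓝 1) := by
  have h := P.tendsto_tower.sub P.tendsto_measureReal_base
  rw [sub_zero] at h
  refine h.congr fun n => ?_
  rw [Nat.cast_sub (P.h_pos n)]
  push_cast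
  ring

theorem measureReal_compl_interior (n : ℕ) :
    μ.real (P.levels n (Finset.range (P.h n - 1)))ᶜ =
      1 - ((P.h n - 1 : ℕ) : ℝ) * μ.real (P.base n) := by
  rw [measureReal_compl (P.measurableSet_levels n _), probReal_univ,
    P.measureReal_levels (fun i hi => by rw [Finset.mem_range] at hi; omega), Finset.card_range]

theorem exists_index_sequence (κ : OdometerSequence)
    (h : ∀ k ∈ κ.factors, ∀ η : ℝ, 0 < η → ∃ N : ℕ, ∀ m n : ℕ, N ≤ m → m ≤ n → ∃ j : ZMod k,
      (((P.I m n).filter (fun i : ℕ => (i : ZMod k) ≠ j)).card : ℝ) /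
        ((P.I m n).card : ℝ) < η) :
    ∃ (m : ℕ → ℕ) (c : ℕ → ℤ), Tendsto m atTop atTop ∧ ∀ᵐ x ∂μ, ∀ᶠ t in atTop,
      (∃ i, i + 1 < P.h (m t) ∧ x ∈ P.level (m t) i) ∧
      ((P.index (m (t + 1)) x - c (t + 1) : ℤ) : ZMod (κ.k t)) =
        ((P.index (m t) x - c t : ℤ) : ZMod (κ.k t)) := by
  have hN : ∀ t : ℕ, ∃ N : ℕ, ∀ m, N ≤ m →
      1 - (1 / 2) ^ t < ((P.h m - 1 : ℕ) : ℝ) * μ.real (P.base m) ∧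
      ∀ n, m ≤ n → ∃ j : ZMod (κ.k t),
        (((P.I m n).filter (fun i : ℕ => (i : ZMod (κ.k t)) ≠ j)).card : ℝ) /
          ((P.I m n).card : ℝ) < (1 / 2) ^ t := by
    intro t
    have hpos : (0 : ℝ) < (1 / 2) ^ t := by positivity
    obtain ⟨N₁, hN₁⟩ := h (κ.k t) ⟨t, dvd_rfl⟩ ((1 / 2) ^ t) hpos
    obtain ⟨N₂, hN₂⟩ := eventually_atTop.1
      (P.tendsto_interior.eventually (lt_mem_nhds (sub_lt_self 1 hpos)))
    exact ⟨max N₁ N₂, fun m hm => ⟨hN₂ m ((le_max_right _ _).trans hm), fun n hmn =>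
      hN₁ m n ((le_max_left _ _).trans hm) hmn⟩⟩
  choose N hN using hN
  -- Partial sums make `m` monotone and at least `N t`; the summand `t` makes it tend to infinity.
  let m : ℕ → ℕ := fun t => t + ∑ u ∈ Finset.range (t + 1), N u
  have hNm : ∀ t, N t ≤ m t := fun t =>
    (Finset.single_le_sum (fun _ _ => Nat.zero_le _) (Finset.self_mem_range_succ t)).trans
      (Nat.le_add_left _ _)
  have hmm : ∀ t, m t ≤ m (t + 1) := fun t => by
    simp only [m, Finset.sum_range_succ _ (t + 1)]
    omega
  choose j hj using fun t => (hN t (m t) (hNm t)).2 (m (t + 1)) (hmm t)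
  -- Passing from stage `m t` to `m (t + 1)` typically raises the index by `j t` modulo `k t`; `c`
  -- accumulates representatives of these shifts.
  let c : ℕ → ℤ := fun t => ∑ u ∈ Finset.range t, ((j u).val : ℤ)
  refine ⟨m, c, tendsto_atTop_mono (fun t => Nat.le_add_right t _) tendsto_id, ?_⟩
  -- The levels belonging to copies of tower `m t` that start at an exceptional position. Their
  -- total measure is at most `(1 / 2) ^ t` times that of tower `m t`.
  let J : ℕ → Finset ℕ := fun t => Finset.image₂ (· + ·) (Finset.range (P.h (m t)))
    ((P.I (m t) (m (t + 1))).filter (fun i : ℕ => (i : ZMod (κ.k t)) ≠ j t))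
  have hJ : ∀ t, μ.real (P.levels (m (t + 1)) (J t)) ≤ (1 / 2) ^ t := by
    intro t
    have h1 : ((J t).card : ℝ) ≤ P.h (m t) *
        ((P.I (m t) (m (t + 1))).filter (fun i : ℕ => (i : ZMod (κ.k t)) ≠ j t)).card := by
      have := Finset.card_image₂_le (· + ·) (Finset.range (P.h (m t)))
        ((P.I (m t) (m (t + 1))).filter (fun i : ℕ => (i : ZMod (κ.k t)) ≠ j t))
      rw [Finset.card_range] at this
      exact_mod_cast this
    have h2 := (div_lt_iff₀ (P.card_I_pos (hmm t))).1 (hj t)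
    have h3 : (0 : ℝ) ≤ P.h (m t) := Nat.cast_nonneg _
    calc μ.real (P.levels (m (t + 1)) (J t))
        ≤ (J t).card * μ.real (P.base (m (t + 1))) := P.measureReal_levels_le _ _
      _ ≤ P.h (m t) * ((1 / 2) ^ t * (P.I (m t) (m (t + 1))).card) *
          μ.real (P.base (m (t + 1))) := by
        refine mul_le_mul_of_nonneg_right (h1.trans ?_) measureReal_nonneg
        exact mul_le_mul_of_nonneg_left h2.le h3
      _ = (1 / 2) ^ t * (P.h (m t) * μ.real (P.base (m t))) := by
        rw [← P.card_I_mul (hmm t)]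
        ring
      _ ≤ (1 / 2) ^ t := mul_le_of_le_one_right (by positivity) (P.tower_le_one _)
  have hV : ∀ t, μ.real (P.levels (m t) (Finset.range (P.h (m t) - 1)))ᶜ ≤ (1 / 2) ^ t := by
    intro t
    rw [measureReal_compl_interior]
    linarith [(hN t (m t) (hNm t)).1]
  filter_upwards [ae_eventually_notMem_of_measureReal_le_geometric hJ,
    ae_eventually_notMem_of_measureReal_le_geometric hV, ae_all_iff.2 P.ae_index_eq,
    ae_all_iff.2 fun t => P.ae_mem_level_iff (hmm t)] with x hxJ hxV hidx hlev
  filter_upwards [hxJ, hxV] with t h1 h2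
  obtain ⟨i, hi, hxi⟩ := P.mem_levels.1 (not_not.1 h2)
  rw [Finset.mem_range] at hi
  refine ⟨⟨i, by omega, hxi⟩, ?_⟩
  obtain ⟨a, ha, hxa⟩ := (hlev t i).1 hxi
  have haj : (a : ZMod (κ.k t)) = j t := by
    by_contra hne
    exact h1 (P.mem_levels.2 ⟨i + a, Finset.mem_image₂.2
      ⟨i, by simp; omega, a, Finset.mem_filter.2 ⟨ha, hne⟩, rfl⟩, hxa⟩)
  have hale := P.add_h_le_of_mem_I (hmm t) ha
  rw [hidx _ i (by omega) hxi, hidx _ (i + a) (by omega) hxa]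
  have hc : c (t + 1) = c t + (j t).val := Finset.sum_range_succ _ _
  rw [hc]
  push_cast
  rw [ZMod.natCast_zmod_val, haj]
  ring

theorem exists_factorMap {κ : OdometerSequence} {m : ℕ → ℕ} {c : ℕ → ℤ}
    (h : ∀ᵐ x ∂μ, ∀ᶠ t in atTop,
      (∃ i, i + 1 < P.h (m t) ∧ x ∈ P.level (m t) i) ∧
      ((P.index (m (t + 1)) x - c (t + 1) : ℤ) : ZMod (κ.k t)) =
        ((P.index (m t) x - c t : ℤ) : ZMod (κ.k t))) :
    ∃ φ : X → κ.space, T.IsFactorMap κ.odometer φ ∧ ∀ᵐ x ∂μ, ∀ n, ∀ᶠ t in atTop,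
      ((P.index (m t) x - c t : ℤ) : ZMod (κ.k n)) = (φ x).1 n := by
  obtain ⟨φ, hφ, hlim⟩ := measurable_limit_of_tendsto_metrizable_ae (μ := μ) (L := atTop)
    (f := fun t x => (P.index (m t) x - c t : ℤ) • κ.one)
    (fun t => ((Measurable.of_discrete (f := fun i : ℕ => ((i : ℤ) - c t) • κ.one)).comp
      (P.measurable_index (m t))).aemeasurable)
    (by
      filter_upwards [h] with x hx
      exact κ.exists_tendsto_zsmul_one (hx.mono fun t ht => ht.2))
  have hcoord : ∀ᵐ x ∂μ, ∀ n, ∀ᶠ t in atTop,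
      ((P.index (m t) x - c t : ℤ) : ZMod (κ.k n)) = (φ x).1 n := by
    filter_upwards [hlim] with x hx n
    exact κ.eventually_coord_eq hx n
  have hT : ∀ᵐ x ∂μ, φ (T.toFun x) = φ x + κ.one := by
    filter_upwards [h, hcoord, T.measurePreserving.quasiMeasurePreserving.ae hcoord,
      ae_all_iff.2 P.ae_index_eq,
      T.measurePreserving.quasiMeasurePreserving.ae (ae_all_iff.2 P.ae_index_eq),
      ae_all_iff.2 P.ae_toFun_mem_level] with x h1 h2 h3 h4 h5 h6
    refine Subtype.ext (funext fun n => ?_)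
    -- At such a `t` both coordinates have reached their limits and `x` is below the top level, so
    -- `T` raises the index by exactly one.
    obtain ⟨t, ⟨⟨i, hi, hxi⟩, -⟩, h2, h3⟩ := (h1.and ((h2 n).and (h3 n))).exists
    rw [h4 _ i (by omega) hxi] at h2
    rw [h5 _ (i + 1) hi (h6 _ i hxi)] at h3
    rw [κ.coe_add_one, ← h2, ← h3]
    push_cast
    ring
  exact ⟨φ, ⟨κ.measurePreserving_of_equivariant hφ hT, hT⟩, hcoord⟩

/-- The error has three sources, each of measure at most `ε`: points outside the tower without its
top level, points whose coordinate has not yet reached its limit, and levels on which the residue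
test misjudges membership in the base. -/
theorem base_approx_preimage {κ : OdometerSequence} {m : ℕ → ℕ} {c : ℕ → ℤ}
    (hm : Tendsto m atTop atTop) {φ : X → κ.space} (hφ : Measurable φ)
    (hlim : ∀ᵐ x ∂μ, ∀ n, ∀ᶠ t in atTop,
      ((P.index (m t) x - c t : ℤ) : ZMod (κ.k n)) = (φ x).1 n)
    {l k N : ℕ} (hk : k ∈ κ.factors) (hlN : l ≤ N) {ε : ℝ} (hε : 0 < ε)
    (h : ∀ m : ℕ, N ≤ m → ∃ D : Finset (ZMod k),
        ((((Finset.range (P.h m + 1)).filter (fun i : ℕ => (i : ZMod k) ∈ D)) ∆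
            P.I l m).card : ℝ) / ((P.I l m).card : ℝ) < ε) :
    ∃ G, MeasurableSet G ∧ μ.real (P.base l ∆ (φ ⁻¹' G)) < 3 * ε := by
  obtain ⟨n, hkn⟩ := hk
  let bad : ℕ → Set X := fun t =>
    {x | ((P.index (m t) x - c t : ℤ) : ZMod (κ.k n)) ≠ (φ x).1 n}
  have hbadm : ∀ t, MeasurableSet (bad t) := fun t =>
    (measurableSet_eq_fun ((Measurable.of_discrete
      (f := fun i : ℕ => (((i : ℤ) - c t : ℤ) : ZMod (κ.k n)))).comp (P.measurable_index (m t)))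
      ((κ.measurable_coord n).comp hφ)).compl
  have hbad : Tendsto (fun t => μ.real (bad t)) atTop (𝓝 0) := by
    have h1 := tendsto_measure_of_ae_tendsto_indicator_of_isFiniteMeasure (μ := μ) atTop
      MeasurableSet.empty hbadm (by
        filter_upwards [hlim] with x hx
        filter_upwards [hx n] with t ht
        exact ⟨fun h => h ht, False.elim⟩)
    have h2 := (ENNReal.tendsto_toReal (measure_ne_top μ ∅)).comp h1
    rw [measure_empty, ENNReal.toReal_zero] at h2
    exact h2
  obtain ⟨t, ⟨h1, h2⟩, h3⟩ := (((hbad.eventually (gt_mem_nhds hε)).and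
    ((P.tendsto_interior.comp hm).eventually (lt_mem_nhds (sub_lt_self 1 hε)))).and
      (hm.eventually (eventually_ge_atTop N))).exists
  obtain ⟨D, hD⟩ := h (m t) h3
  have hlm : l ≤ m t := hlN.trans h3
  -- For good points the index is the coordinate of `φ x` plus `c t`, hence the shift by `c t`.
  refine ⟨κ.cylinder n {a | ZMod.castHom hkn (ZMod k) a + c t ∈ D},
    κ.measurableSet_cylinder _ _, ?_⟩
  -- `S` may contain the index `h (m t)`, outside the tower; this is harmless, as the bound on the
  -- measure of `levels` needs no disjointness.
  set S := (Finset.range (P.h (m t) + 1)).filter (fun i : ℕ => (i : ZMod k) ∈ D) ∆ P.I l (m t)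
    with hS
  set V := P.levels (m t) (Finset.range (P.h (m t) - 1)) with hV
  have hsub : μ.real (P.base l ∆ (φ ⁻¹' κ.cylinder n {a | ZMod.castHom hkn (ZMod k) a + c t ∈ D})) ≤
      μ.real (Vᶜ ∪ bad t ∪ P.levels (m t) S) := by
    refine ENNReal.toReal_mono (measure_ne_top _ _) (measure_mono_ae ?_)
    filter_upwards [P.ae_index_eq (m t), P.ae_mem_base_iff hlm] with x hidx hbase hx
    change x ∈ Vᶜ ∪ bad t ∪ P.levels (m t) S
    by_contra hcon
    simp only [Set.mem_union, not_or, Set.mem_compl_iff, not_not] at hcon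
    obtain ⟨⟨hxV, hxbad⟩, hxS⟩ := hcon
    obtain ⟨i, hi, hxi⟩ := P.mem_levels.1 hxV
    rw [Finset.mem_range] at hi
    have hi' : i < P.h (m t) := by omega
    have hφx : (φ x).1 n = ((i - c t : ℤ) : ZMod (κ.k n)) := by
      have := not_not.1 hxbad
      rw [hidx i hi' hxi] at this
      exact this.symm
    have hmem : φ x ∈ κ.cylinder n {a | ZMod.castHom hkn (ZMod k) a + c t ∈ D} ↔
        (i : ZMod k) ∈ D := by
      rw [OdometerSequence.cylinder, Set.mem_ofPred_eq, hφx, Set.mem_ofPred_eq, map_intCast]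
      push_cast
      rw [sub_add_cancel]
    have hiS : i ∉ S := fun h => hxS (P.mem_levels.2 ⟨i, h, hxi⟩)
    have hx' : x ∈ P.base l ∆ (φ ⁻¹' κ.cylinder n {a | ZMod.castHom hkn (ZMod k) a + c t ∈ D}) := hx
    rw [Set.mem_symmDiff, Set.mem_preimage, hmem, hbase i hi' hxi] at hx'
    refine hiS ?_
    rw [hS, Finset.mem_symmDiff, Finset.mem_filter, Finset.mem_range]
    have : i < P.h (m t) + 1 := by omega
    tauto
  have hVm : μ.real Vᶜ < ε := by
    rw [hV, measureReal_compl_interior]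
    simp only [Function.comp_apply] at h2
    linarith
  have hSm : μ.real (P.levels (m t) S) ≤ ε := by
    have h4 := (div_lt_iff₀ (P.card_I_pos hlm)).1 hD
    calc μ.real (P.levels (m t) S) ≤ S.card * μ.real (P.base (m t)) := P.measureReal_levels_le _ _
      _ ≤ ε * (P.I l (m t)).card * μ.real (P.base (m t)) :=
        mul_le_mul_of_nonneg_right h4.le measureReal_nonneg
      _ = ε * μ.real (P.base l) := by rw [← P.card_I_mul hlm]; ring
      _ ≤ ε := mul_le_of_le_one_right hε.le measureReal_le_one
  have h5 := measureReal_union_le (μ := μ) (Vᶜ ∪ bad t) (P.levels (m t) S)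
  have h6 := measureReal_union_le (μ := μ) Vᶜ (bad t)
  linarith

/-- Equivariance moves the property from the base to all levels, and the property is closed under
finite unions and under approximation in measure. -/
theorem exists_preimage_of_base {κ : OdometerSequence} {φ : X → κ.space}
    (hφ : T.IsFactorMap κ.odometer φ)
    (hbase : ∀ l, ∃ G, MeasurableSet G ∧ ∀ᵐ x ∂μ, x ∈ P.base l ↔ φ x ∈ G)
    {A : Set X} (hA : MeasurableSet A) :
    ∃ G, MeasurableSet G ∧ ∀ᵐ x ∂μ, x ∈ A ↔ φ x ∈ G := by
  have hinv : ∀ᵐ x ∂μ, φ (T.invFun x) = φ x - κ.one := by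
    filter_upwards [T.measurePreserving_inv.quasiMeasurePreserving.ae hφ.2, T.right_inv]
      with x h1 h2
    rw [h2] at h1
    exact eq_sub_of_add_eq h1.symm
  have hlevel : ∀ l i, ∃ G, MeasurableSet G ∧ ∀ᵐ x ∂μ, x ∈ P.level l i ↔ φ x ∈ G := by
    intro l i
    induction i with
    | zero => exact hbase l
    | succ i ih =>
      obtain ⟨G, hG, hGi⟩ := ih
      refine ⟨(fun α => α - κ.one) ⁻¹' G,
        (measurePreserving_sub_right κ.measure κ.one).measurable hG, ?_⟩
      filter_upwards [T.measurePreserving_inv.quasiMeasurePreserving.ae hGi, hinv] with x h1 h2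
      rw [Set.mem_preimage, ← h2, ← h1]
      rfl
  choose G hG hGl using hlevel
  refine exists_preimage_of_approx fun ε hε => ?_
  obtain ⟨n, J, -, hJ⟩ := P.exists_levels_approx hA hε
  refine ⟨⋃ i ∈ J, G n i, Finset.measurableSet_biUnion _ fun i _ => hG n i, ?_⟩
  have h1 : P.levels n J =ᵐ[μ] φ ⁻¹' ⋃ i ∈ J, G n i := by
    refine eventuallyEq_set.2 ?_
    filter_upwards [ae_all_iff.2 (hGl n)] with x hx
    simp [mem_levels, hx]
  rwa [measureReal_congr ((ae_eq_refl A).symmDiff h1)] at hJ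

theorem isomorphic_of_residues [StandardBorelSpace X] {κ : OdometerSequence}
    (ha : ∀ k ∈ κ.factors, ∀ η : ℝ, 0 < η → ∃ N : ℕ, ∀ m n : ℕ, N ≤ m → m ≤ n → ∃ j : ZMod k,
      (((P.I m n).filter (fun i : ℕ => (i : ZMod k) ≠ j)).card : ℝ) /
        ((P.I m n).card : ℝ) < η)
    (hb : ∀ l : ℕ, ∀ ε : ℝ, 0 < ε → ∃ k ∈ κ.factors, ∃ N : ℕ, l ≤ N ∧ ∀ m : ℕ, N ≤ m →
      ∃ D : Finset (ZMod k),
        ((((Finset.range (P.h m + 1)).filter (fun i : ℕ => (i : ZMod k) ∈ D)) ∆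
            P.I l m).card : ℝ) / ((P.I l m).card : ℝ) < ε) :
    T.Isomorphic κ.odometer := by
  obtain ⟨m, c, hm, h⟩ := P.exists_index_sequence κ ha
  obtain ⟨φ, hφ, hlim⟩ := P.exists_factorMap h
  have : Nonempty X := nonempty_of_isProbabilityMeasure μ
  have hbase : ∀ l, ∃ G, MeasurableSet G ∧ ∀ᵐ x ∂μ, x ∈ P.base l ↔ φ x ∈ G := by
    refine fun l => exists_preimage_of_approx fun ε hε => ?_
    obtain ⟨k, hk, N, hlN, hN⟩ := hb l (ε / 3) (by positivity)
    obtain ⟨G, hG, hGε⟩ := P.base_approx_preimage hm hφ.1.measurable hlim hk hlN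
      (show 0 < ε / 3 by positivity) hN
    exact ⟨G, hG, by linarith⟩
  obtain ⟨ψ, hψ, h1, h2⟩ :=
    hφ.1.exists_ae_inverse fun A hA => P.exists_preimage_of_base hφ hbase hA
  exact ⟨φ, ψ, hφ, hψ, h1, h2⟩

end RankOnePresentation

theorem mainTheorem1 {X : Type*} [MeasurableSpace X] [StandardBorelSpace X]
    (μ : Measure X) [IsProbabilityMeasure μ] [NullSingletonClass μ]
    (T : MPTransformation μ) (P : RankOnePresentation T)
    (K : Set ℕ) (hK : K.Infinite) (κ : OdometerSequence) (hκ : K = κ.factors) :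
    T.Isomorphic κ.odometer ↔
      (∀ k ∈ K, ∀ η : ℝ, 0 < η → ∃ N : ℕ, ∀ m n : ℕ, N ≤ m → m ≤ n → ∃ j : ZMod k,
        (((P.I m n).filter (fun i : ℕ => (i : ZMod k) ≠ j)).card : ℝ) /
          ((P.I m n).card : ℝ) < η) ∧
      (∀ l : ℕ, ∀ ε : ℝ, 0 < ε → ∃ k ∈ K, ∃ N : ℕ, l ≤ N ∧ ∀ m : ℕ, N ≤ m →
        ∃ D : Finset (ZMod k),
          ((((Finset.range (P.h m + 1)).filter (fun i : ℕ => (i : ZMod k) ∈ D)) ∆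
              P.I l m).card : ℝ) /
            ((P.I l m).card : ℝ) < ε) := by
  subst hκ
  exact ⟨P.residues_of_isomorphic, fun h => P.isomorphic_of_residues h.1 h.2⟩
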